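/- All topological spaces are completely regular and Hausdorff, and $\mathsf{Top}$ denotes the category of these spaces and continuous maps. Let $\mathsf{P}\subset\mathsf{Top}$ be a full subcategory. A functorial $\mathsf{P}$-ification of a space $X$ is a continuous map $i\colon X\to N$ with $N\in\mathsf{P}$ such that for every $Y\in\mathsf{P}$ and every continuous map $f\colon X\to Y$ there is a unique continuous map $\tilde f\colon N\to Y$ with $f=\tilde f\circ i$. Let $\mathsf{P}^{\nu}\subset\mathsf{Top}$ be the full subcategory of all spaces that admit a functorial $\mathsf{P}$-ification (the functorially $\mathsf{P}$-ifiable spaces). Let $\mathsf{Cpt}$, $\mathsf{RCpt}$ and $\mathsf{PsCpt}$ be the full subcategories of $\mathsf{Top}$ consisting, respectively, of the compact spaces, of the realcompact spaces (those that admit a closed embedding into $\mathbb{R}^{\kappa}$ for some cardinal $\kappa$), and of the pseudocompact spaces (those on which every continuous real-valued function is bounded). Proposition. Suppose that $\mathsf{Cpt}\subset\mathsf{P}$, $\mathbb{R}\in\mathsf{P}$ and $\mathsf{P}\subset\mathsf{RCpt}$. Then $\mathsf{PsCpt}\subset\mathsf{P}^{\nu}$, that is, every pseudocompact space is functorially $\mathsf{P}$-ifiable.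 In particular, $\mathsf{P}\subsetneq\mathsf{P}^{\nu}$. -/

import Mathlib

open CategoryTheory

universe u

namespace Pification

/-- The category of completely regular Hausdorff spaces and continuous maps, as a full subcategory
of the category of all topological spaces. -/
abbrev Tych : Type (u + 1) :=
  ObjectProperty.FullSubcategory (fun X : TopCat.{u} => T35Space X)

/-- `i : X → N` is a functorial `P`-ification of `X`: the space `N` belongs to `P`, and every
continuous map `f` from `X` to a space `Y` in `P` factors uniquely through `i` as `f = g ∘ i`
with `g : N → Y` continuous. -/
def IsPification (P : ObjectProperty Tych.{u}) {X N : Tych.{u}} (i : C(X.obj, N.obj)) : Prop :=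
  P N ∧ ∀ Y : Tych.{u}, P Y → ∀ f : C(X.obj, Y.obj), ∃! g : C(N.obj, Y.obj), f = g.comp i

/-- The full subcategory of the functorially `P`-ifiable spaces. -/
def Pifiable (P : ObjectProperty Tych.{u}) : ObjectProperty Tych.{u} :=
  fun X => ∃ (N : Tych.{u}) (i : C(X.obj, N.obj)), IsPification P i

/-- The full subcategory of compact Hausdorff spaces. -/
def Cpt : ObjectProperty Tych.{u} :=
  fun X => CompactSpace X.obj

/-- The full subcategory of realcompact spaces: those which admit a closed embedding into a power
of the real line. -/
def RCpt : ObjectProperty Tych.{u} :=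
  fun X => ∃ (ι : Type u) (e : X.obj → (ι → ℝ)), Topology.IsClosedEmbedding e

/-- The full subcategory of pseudocompact spaces: every continuous real-valued function is
bounded. -/
def PsCpt : ObjectProperty Tych.{u} :=
  fun X => ∀ f : C(X.obj, ℝ), ∃ M : ℝ, ∀ x : X.obj, |f x| ≤ M

/-- The real line belongs to `P`. In an arbitrary universe this says that some member of `P` is
homeomorphic to `ℝ`. -/
def ContainsReal (P : ObjectProperty Tych.{u}) : Prop :=
  ∃ R : Tych.{u}, P R ∧ Nonempty (R.obj ≃ₜ ℝ)

end Pification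

namespace Pification

/-! Each coordinate of a map from a pseudocompact `X` into a closed subspace of a power of `ℝ` is
bounded, so the image lies in a compact box. Hence every map from `X` to a member of `P` extends
over `StoneCech X`, which is compact and so lies in `P`: it is the `P`-ification. For strictness, a
pseudocompact realcompact space is compact, so a noncompact pseudocompact space, here an uncountable
`Σ`-product, lies outside `P`. -/

/-- A continuous map from a pseudocompact space to a realcompact space has relatively compact
image. -/
theorem isCompact_closure_range {X Y : Tych.{u}} (hX : PsCpt X) (hY : RCpt Y)
    (f : C(X.obj, Y.obj)) : IsCompact (closure (Set.range f)) := by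
  have : T35Space Y.obj := Y.property
  obtain ⟨ι, e, he⟩ := hY
  have hb (k : ι) : ∃ M : ℝ, ∀ x, |e (f x) k| ≤ M :=
    hX ⟨fun x => e (f x) k, (continuous_apply k).comp (he.continuous.comp f.continuous)⟩
  choose M hM using hb
  have hK : IsCompact (e ⁻¹' Set.univ.pi fun k => Set.Icc (-M k) (M k)) :=
    he.isCompact_preimage (isCompact_univ_pi fun _ => isCompact_Icc)
  refine hK.closure_of_subset ?_
  rintro _ ⟨x, rfl⟩ k -
  exact abs_le.mp (hM k x)

/-- A continuous map from a pseudocompact space to a realcompact space extends uniquely to the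
Stone–Čech compactification. -/
theorem existsUnique_stoneCech_extension {X Y : Tych.{u}} (hX : PsCpt X) (hY : RCpt Y)
    (f : C(X.obj, Y.obj)) :
    ∃! g : C(StoneCech X.obj, Y.obj), f = g.comp ⟨stoneCechUnit, continuous_stoneCechUnit⟩ := by
  have : T35Space Y.obj := Y.property
  have : CompactSpace (closure (Set.range f)) :=
    isCompact_iff_compactSpace.mp (isCompact_closure_range hX hY f)
  have hc : Continuous fun x => (⟨f x, subset_closure ⟨x, rfl⟩⟩ : closure (Set.range f)) :=
    f.continuous.subtype_mk _
  refine ⟨⟨fun z => (stoneCechExtend hc z).1,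
    continuous_subtype_val.comp (continuous_stoneCechExtend hc)⟩, ?_, fun g hg => ?_⟩
  · ext x
    exact (congrArg Subtype.val (congrFun (stoneCechExtend_extends hc) x)).symm
  · apply DFunLike.coe_injective
    refine denseRange_stoneCechUnit.equalizer g.continuous
      (continuous_subtype_val.comp (continuous_stoneCechExtend hc)) (funext fun x => ?_)
    exact (DFunLike.congr_fun hg x).symm.trans
      (congrArg Subtype.val (congrFun (stoneCechExtend_extends hc) x)).symm

theorem compactSpace_of_psCpt_of_rCpt {X : Tych.{u}} (hX : PsCpt X) (hX' : RCpt X) :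
    CompactSpace X.obj := by
  have h := isCompact_closure_range hX hX' (ContinuousMap.id _)
  rw [ContinuousMap.coe_id, Set.range_id, closure_univ] at h
  exact ⟨h⟩

/-- The `Σ`-product in the Cantor cube `ι → Bool`: the points of countable support. -/
abbrev SigmaProduct (ι : Type u) : Type u :=
  {s : ι → Bool // {i | s i = true}.Countable}

/-- Countably many points of a `Σ`-product lie in a common compact subset. -/
theorem SigmaProduct.exists_isCompact {ι : Type u} (x : ℕ → SigmaProduct ι) :
    ∃ K : Set (SigmaProduct ι), IsCompact K ∧ ∀ n, x n ∈ K := by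
  -- All points supported in the countable union `C` of the supports form a closed subset of the
  -- cube lying inside the `Σ`-product.
  let C : Set ι := ⋃ n, {i | (x n).1 i = true}
  have hC : C.Countable := Set.countable_iUnion fun n => (x n).2
  let T : Set (ι → Bool) := {s | ∀ i, i ∉ C → s i = false}
  have hT : IsClosed T := by
    simp only [T, Set.ofPred_forall]
    exact isClosed_iInter fun i => isClosed_iInter fun _ =>
      isClosed_eq (continuous_apply i) continuous_const
  have hsub : T ⊆ Set.range (Subtype.val : SigmaProduct ι → ι → Bool) := by
    intro s hs
    refine ⟨⟨s, hC.mono fun i hi => ?_⟩, rfl⟩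
    by_contra hiC
    exact Bool.false_ne_true ((hs i hiC).symm.trans hi)
  refine ⟨Subtype.val ⁻¹' T,
    (Topology.IsInducing.subtypeVal.isCompact_preimage_iff hsub).mpr hT.isCompact,
    fun n i hi => ?_⟩
  by_contra h
  exact hi (Set.mem_iUnion.mpr ⟨n, Bool.eq_true_of_not_eq_false h⟩)

/-- Unboundedness would already show on a sequence, which lies in a compact set. -/
theorem SigmaProduct.exists_bound {ι : Type u} (f : C(SigmaProduct ι, ℝ)) :
    ∃ M : ℝ, ∀ x, |f x| ≤ M := by
  by_contra! h
  choose x hx using fun n : ℕ => h n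
  obtain ⟨K, hK, hxK⟩ := SigmaProduct.exists_isCompact x
  obtain ⟨M, hM⟩ := hK.exists_bound_of_continuousOn f.continuous.continuousOn
  obtain ⟨n, hn⟩ := exists_nat_gt M
  exact (hn.trans (hx n)).not_ge (hM _ (hxK n))

/-- Indicators of finite sets converge to the constant `true`, whose support is uncountable, so the
`Σ`-product is not closed in the cube. -/
theorem SigmaProduct.not_compactSpace {ι : Type u} [Uncountable ι] :
    ¬ CompactSpace (SigmaProduct ι) := by
  classical
  intro _
  have hcl : IsClosed (Set.range (Subtype.val : SigmaProduct ι → ι → Bool)) :=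
    (isCompact_range continuous_subtype_val).isClosed
  have hlim : Filter.Tendsto (fun (F : Finset ι) (i : ι) => decide (i ∈ F)) Filter.atTop
      (nhds fun _ => true) := by
    refine tendsto_pi_nhds.mpr fun i => tendsto_const_nhds.congr' ?_
    filter_upwards [Filter.eventually_ge_atTop {i}] with F hF
    exact (decide_eq_true (hF (Finset.mem_singleton_self i))).symm
  obtain ⟨s, hs⟩ := hcl.mem_of_tendsto hlim (Filter.Eventually.of_forall fun F =>
    ⟨⟨_, F.countable_toSet.mono fun i hi => of_decide_eq_true hi⟩, rfl⟩)
  refine Set.not_countable_univ (α := ι) (s.2.mono fun i _ => ?_)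
  exact congrFun hs i

/-- There is a pseudocompact space which is not realcompact. -/
theorem exists_psCpt_not_rCpt : ∃ X : Tych.{u}, PsCpt X ∧ ¬ RCpt X := by
  let X : Tych.{u} := ⟨TopCat.of (SigmaProduct (ULift.{u} ℝ)),
    inferInstanceAs (T35Space (SigmaProduct (ULift.{u} ℝ)))⟩
  have hX : PsCpt X := SigmaProduct.exists_bound
  exact ⟨X, hX, fun h => SigmaProduct.not_compactSpace (compactSpace_of_psCpt_of_rCpt hX h)⟩

theorem le_pifiable (P : ObjectProperty Tych.{u}) : P ≤ Pifiable P := fun X hX =>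
  ⟨X, ContinuousMap.id _, hX, fun _ _ f => ⟨f, rfl, fun _ hg => hg.symm⟩⟩

theorem psCpt_le_pifiable {P : ObjectProperty Tych.{u}} (hCpt : Cpt ≤ P) (hRCpt : P ≤ RCpt) :
    PsCpt ≤ Pifiable P := fun X hX =>
  ⟨⟨TopCat.of (StoneCech X.obj), inferInstanceAs (T35Space (StoneCech X.obj))⟩,
    ⟨stoneCechUnit, continuous_stoneCechUnit⟩,
    hCpt _ (inferInstanceAs (CompactSpace (StoneCech X.obj))),
    fun Y hY f => existsUnique_stoneCech_extension hX (hRCpt Y hY) f⟩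

end Pification

theorem mainTheorem9 (P : ObjectProperty Pification.Tych.{u})
    (hCpt : Pification.Cpt ≤ P) (hReal : Pification.ContainsReal P)
    (hRCpt : P ≤ Pification.RCpt) :
    Pification.PsCpt ≤ Pification.Pifiable P ∧ P < Pification.Pifiable P := by
  have h := Pification.psCpt_le_pifiable hCpt hRCpt
  obtain ⟨X, hX, hX'⟩ := Pification.exists_psCpt_not_rCpt.{u}
  exact ⟨h, lt_of_le_not_ge (Pification.le_pifiable P) fun hle => hX' (hRCpt X (hle X (h X hX)))⟩
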